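/- Let $(\mathscr C,\mathbb E,\mathfrak s)$ be an extriangulated category in the sense of Nakaoka and Palu. For a class $\mathcal Y$ of objects of an extriangulated category $\mathscr D$, a $\mathcal Y$-filtration of length $n\ge 0$ of an object $M$ is a sequence of inflations $0=M_0\to M_1\to\cdots\to M_n=M$ in $\mathscr D$ whose cones $Y_1,\dots,Y_n$ lie in $\mathcal Y$; we write $M\sim(Y_1,\dots,Y_n)_{\mathcal Y}$. Let $\mathbf{Filt}_{\mathscr D}(\mathcal Y)$ be the full subcategory of the objects that have a $\mathcal Y$-filtration, and for such an object $M$ let $l_{\mathcal Y}(M)$ be the minimal length of its $\mathcal Y$-filtrations. We say that $\mathscr D$ satisfies the Jordan–Hölder property (JHP) with respect to $\mathcal Y$ if 1. $\mathscr D=\mathbf{Filt}_{\mathscr D}(\mathcal Y)$; 2. whenever $M\sim(Y_1,\dots,Y_n)_{\mathcal Y}$ and $M\sim(Y_1',\dots,Y_n')_{\mathcal Y}$ with $n=l_{\mathcal Y}(M)$, there is a permutation $\sigma$ of $\{1,\dots,n\}$ with $Y_i\cong Y'_{\sigma(i)}$ for all $i$; and 3. for each object $M$ all $\mathcal Y$-filtrations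 of $M$ have the same length. We say that $\mathscr D$ satisfies (JHP) if it satisfies (JHP) with respect to some class $\mathcal Y$ of its objects. Let $\mathcal X$ be a semibrick in $\mathscr C$, that is, a class of objects whose endomorphism rings are division rings, with $\operatorname{Hom}_{\mathscr C}(X_1,X_2)=0$ for any two non-isomorphic $X_1,X_2\in\mathcal X$. Call $\mathcal X$ proper if for no $X\in\mathcal X$ there is an $\mathbb E$-triangle $X\to 0\to N\dashrightarrow$ with $N\in\mathbf{Filt}_{\mathscr C}(\mathcal X)$ (that is, $X[1]\notin\mathbf{Filt}_{\mathscr C}(\mathcal X)$ for all $X\in\mathcal X$). Let $\mathcal T=\mathbf{Filt}_{\mathscr C}(\mathcal X)$, which is extension-closed in $\mathscr C$ and hence an extriangulated category with the restrictions of $\mathbb E$ and $\mathfrak s$. **Theorem.** $\mathcal T$ satisfies (JHP) if and only if $\mathcal X$ is proper. Likewise, $\mathcal T$ satisfies (JHP) with respect to $\mathcal X$ itself if and only if $\mathcal X$ is proper. -/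

import Mathlib

open CategoryTheory CategoryTheory.Limits Opposite
open scoped ZeroObject

universe w v u

section Bifunctor

variable {C : Type u} [Category.{v} C]

/-- The group `𝔼(Z, A)` of `𝔼`-extensions, for a bifunctor `𝔼 : Cᵒᵖ × C → Ab` (in curried form). -/
abbrev ExtGroup (E : Cᵒᵖ ⥤ C ⥤ AddCommGrpCat.{w}) (Z A : C) : Type w :=
  ((E.obj (op Z)).obj A : AddCommGrpCat.{w})

/-- The extension `a_* δ = 𝔼(Z, a)(δ)`. -/
def extPush (E : Cᵒᵖ ⥤ C ⥤ AddCommGrpCat.{w}) {Z A A' : C} (a : A ⟶ A')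
    (δ : ExtGroup E Z A) : ExtGroup E Z A' :=
  ((E.obj (op Z)).map a).hom δ

/-- The extension `c^* δ = 𝔼(c, A)(δ)`. -/
def extPull (E : Cᵒᵖ ⥤ C ⥤ AddCommGrpCat.{w}) {Z Z' A : C} (c : Z' ⟶ Z)
    (δ : ExtGroup E Z A) : ExtGroup E Z' A :=
  ((E.map c.op).app A).hom δ

/-- Two sequences `A ⟶ B ⟶ Z` and `A ⟶ B' ⟶ Z` are equivalent if there is an isomorphism `B ≅ B'`
compatible with the identities of `A` and `Z`. -/
def SeqEquiv {A B B' Z : C} (x : A ⟶ B) (y : B ⟶ Z) (x' : A ⟶ B') (y' : B' ⟶ Z) : Prop :=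
  ∃ b : B ≅ B', x ≫ b.hom = x' ∧ b.hom ≫ y' = y

end Bifunctor

section Biproduct

variable {C : Type u} [Category.{v} C] [Preadditive C]

/-- `b` exhibits its apex as a biproduct (the identities `inl ≫ fst = 𝟙`, `inl ≫ snd = 0`,
`inr ≫ fst = 0`, `inr ≫ snd = 𝟙` are part of the notion of a bicone). -/
def IsDirectSum {X Y : C} (b : BinaryBicone X Y) : Prop :=
  b.fst ≫ b.inl + b.snd ≫ b.inr = 𝟙 b.pt

/-- The morphism `f ⊕ f'` between direct sums. -/
def directSumMap {X Y X' Y' : C} (b : BinaryBicone X X') (c : BinaryBicone Y Y')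
    (f : X ⟶ Y) (f' : X' ⟶ Y') : b.pt ⟶ c.pt :=
  b.fst ≫ f ≫ c.inl + b.snd ≫ f' ≫ c.inr

/-- The extension `δ ⊕ δ'`, i.e. the element of `𝔼(Z ⊕ Z', A ⊕ A')` corresponding to
`(δ, 0, 0, δ')` in `𝔼(Z, A) ⊕ 𝔼(Z, A') ⊕ 𝔼(Z', A) ⊕ 𝔼(Z', A')`. -/
def directSumExt (E : Cᵒᵖ ⥤ C ⥤ AddCommGrpCat.{w}) {A A' Z Z' : C}
    (bA : BinaryBicone A A') (bZ : BinaryBicone Z Z')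
    (δ : ExtGroup E Z A) (δ' : ExtGroup E Z' A') : ExtGroup E bZ.pt bA.pt :=
  extPush E bA.inl (extPull E bZ.fst δ) + extPush E bA.inr (extPull E bZ.snd δ')

/-- The underlying direct sum diagram in `C` of one in a full subcategory. -/
abbrev fullSubcategoryBicone {T : ObjectProperty C} {X Y : T.FullSubcategory} (b : BinaryBicone X Y) :
    BinaryBicone X.obj Y.obj :=
  T.ι.mapBinaryBicone b

lemma isDirectSum_bicone {T : ObjectProperty C} {X Y : T.FullSubcategory} {b : BinaryBicone X Y}
    (hb : IsDirectSum b) :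
    IsDirectSum (fullSubcategoryBicone b) :=
  congrArg (fun t : b.pt ⟶ b.pt => t.hom) hb

end Biproduct

/-- An extriangulated structure (Nakaoka–Palu) on an additive category.

The realization `𝔰`, which assigns to every `δ : 𝔼(Z, A)` an equivalence class `𝔰(δ) = [A ⟶ B ⟶ Z]`
of sequences, is encoded by the relation `Realizes x y δ`, meaning `𝔰(δ) = [x, y]`; the first three
axioms on `Realizes` say that for each `δ` the sequences realizing `δ` form exactly one
equivalence class. -/
class Extriangulated (C : Type u) [Category.{v} C] [Preadditive C] [HasZeroObject C]
    [HasFiniteBiproducts C] where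
  /-- the bifunctor `𝔼` -/
  E : Cᵒᵖ ⥤ C ⥤ AddCommGrpCat.{w}
  /-- the realization `𝔰` -/
  Realizes : ∀ {A B Z : C}, (A ⟶ B) → (B ⟶ Z) → ExtGroup E Z A → Prop
  /-- (ET1): `𝔼` is additive in the first variable -/
  additive_left : E.Additive
  /-- (ET1): `𝔼` is additive in the second variable -/
  additive_right : ∀ Z : Cᵒᵖ, (E.obj Z).Additive
  exists_realization : ∀ {A Z : C} (δ : ExtGroup E Z A),
    ∃ (B : C) (x : A ⟶ B) (y : B ⟶ Z), Realizes x y δ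
  seqEquiv_of_realizes : ∀ {A B B' Z : C} {x : A ⟶ B} {y : B ⟶ Z} {x' : A ⟶ B'} {y' : B' ⟶ Z}
    {δ : ExtGroup E Z A}, Realizes x y δ → Realizes x' y' δ → SeqEquiv x y x' y'
  realizes_of_seqEquiv : ∀ {A B B' Z : C} {x : A ⟶ B} {y : B ⟶ Z} {x' : A ⟶ B'} {y' : B' ⟶ Z}
    {δ : ExtGroup E Z A}, Realizes x y δ → SeqEquiv x y x' y' → Realizes x' y' δ
  /-- (ET2): every morphism of extensions `(a, c) : δ ⟶ δ'` lifts to the realizations -/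
  lift_morphism : ∀ {A B Z A' B' Z' : C} {x : A ⟶ B} {y : B ⟶ Z} {x' : A' ⟶ B'} {y' : B' ⟶ Z'}
    {δ : ExtGroup E Z A} {δ' : ExtGroup E Z' A'}, Realizes x y δ → Realizes x' y' δ' →
    ∀ (a : A ⟶ A') (c : Z ⟶ Z'), extPush E a δ = extPull E c δ' →
      ∃ b : B ⟶ B', x ≫ b = a ≫ x' ∧ y ≫ c = b ≫ y'
  /-- (ET2): `𝔰(0) = [A ⟶ A ⊕ Z ⟶ Z]` -/
  realizes_zero : ∀ {A Z : C} (b : BinaryBicone A Z), IsDirectSum b →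
    Realizes b.inl b.snd (0 : ExtGroup E Z A)
  /-- (ET2): `𝔰(δ ⊕ δ') = 𝔰(δ) ⊕ 𝔰(δ')` -/
  realizes_directSum : ∀ {A B Z A' B' Z' : C} {x : A ⟶ B} {y : B ⟶ Z} {x' : A' ⟶ B'}
    {y' : B' ⟶ Z'} {δ : ExtGroup E Z A} {δ' : ExtGroup E Z' A'},
    Realizes x y δ → Realizes x' y' δ' →
    ∀ (bA : BinaryBicone A A') (bB : BinaryBicone B B') (bZ : BinaryBicone Z Z'),
      IsDirectSum bA → IsDirectSum bB → IsDirectSum bZ →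
      Realizes (directSumMap bA bB x x') (directSumMap bB bZ y y') (directSumExt E bA bZ δ δ')
  /-- (ET3) -/
  et3 : ∀ {A B Z A' B' Z' : C} {x : A ⟶ B} {y : B ⟶ Z} {x' : A' ⟶ B'} {y' : B' ⟶ Z'}
    {δ : ExtGroup E Z A} {δ' : ExtGroup E Z' A'}, Realizes x y δ → Realizes x' y' δ' →
    ∀ (a : A ⟶ A') (b : B ⟶ B'), x ≫ b = a ≫ x' →
      ∃ c : Z ⟶ Z', y ≫ c = b ≫ y' ∧ extPush E a δ = extPull E c δ'
  /-- (ET3)ᵒᵖ -/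
  et3_op : ∀ {A B Z A' B' Z' : C} {x : A ⟶ B} {y : B ⟶ Z} {x' : A' ⟶ B'} {y' : B' ⟶ Z'}
    {δ : ExtGroup E Z A} {δ' : ExtGroup E Z' A'}, Realizes x y δ → Realizes x' y' δ' →
    ∀ (b : B ⟶ B') (c : Z ⟶ Z'), y ≫ c = b ≫ y' →
      ∃ a : A ⟶ A', x ≫ b = a ≫ x' ∧ extPush E a δ = extPull E c δ'
  /-- (ET4):
  ```
  A --f--> B --f'--> D
  ‖        |g        |d
  A --h--> Z --h'--> Q
           |g'       |e
           F ======= F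
  ```
  -/
  et4 : ∀ {A B D Z F : C} {f : A ⟶ B} {f' : B ⟶ D} {g : B ⟶ Z} {g' : Z ⟶ F}
    {δ : ExtGroup E D A} {δ' : ExtGroup E F B}, Realizes f f' δ → Realizes g g' δ' →
    ∃ (Q : C) (d : D ⟶ Q) (e : Q ⟶ F) (h' : Z ⟶ Q) (δ'' : ExtGroup E Q A),
      Realizes (f ≫ g) h' δ'' ∧ f' ≫ d = g ≫ h' ∧ h' ≫ e = g' ∧
      Realizes d e (extPush E f' δ') ∧ extPull E d δ'' = δ ∧
      extPush E f δ'' = extPull E e δ'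
  /-- (ET4)ᵒᵖ:
  ```
  D --d--> Q --e--> F
  ‖        |h'      |g'
  D --f'-> A --f--> B
           |h       |g
           Z ====== Z
  ```
  -/
  et4_op : ∀ {D A B F Z : C} {f' : D ⟶ A} {f : A ⟶ B} {g' : F ⟶ B} {g : B ⟶ Z}
    {δ : ExtGroup E B D} {δ' : ExtGroup E Z F}, Realizes f' f δ → Realizes g' g δ' →
    ∃ (Q : C) (d : D ⟶ Q) (e : Q ⟶ F) (h' : Q ⟶ A) (δ'' : ExtGroup E Z Q),
      Realizes h' (f ≫ g) δ'' ∧ d ≫ h' = f' ∧ h' ≫ f = e ≫ g' ∧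
      Realizes d e (extPull E g' δ) ∧ δ' = extPush E e δ'' ∧
      extPush E d δ = extPull E g δ''

section Filtrations

variable {C : Type u} [Category.{v} C] [Preadditive C] [HasZeroObject C]
  [HasFiniteBiproducts C] [Extriangulated.{w} C]

/-- `A ⟶ B ⟶ Z` is a conflation: it is part of an `𝔼`-triangle `A ⟶ B ⟶ Z ⇢`. Then `A ⟶ B` is an
inflation and `Z` is its cone. -/
def IsConflation {A B Z : C} (x : A ⟶ B) (y : B ⟶ Z) : Prop :=
  ∃ δ : ExtGroup (Extriangulated.E.{w} (C := C)) Z A, Extriangulated.Realizes x y δ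

/-- `HasFiltration X M [X₁, …, Xₙ]`: the object `M` has a filtration
`0 = M₀ ⟶ M₁ ⟶ ⋯ ⟶ Mₙ = M` of length `n` by inflations with cones `X₁, …, Xₙ`, all lying in `X`. -/
inductive HasFiltration (X : ObjectProperty C) : C → List C → Prop
  | nil {M : C} (hM : IsZero M) : HasFiltration X M []
  | snoc {M' M S : C} {l : List C} (h : HasFiltration X M' l) (f : M' ⟶ M) (g : M ⟶ S)
      (hfg : IsConflation.{w} f g) (hS : X S) : HasFiltration X M (l ++ [S])

/-- The filtration subcategory `Filt(X)`. -/
def filt (X : ObjectProperty C) : ObjectProperty C :=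
  fun M => ∃ l : List C, HasFiltration.{w} X M l

/-- The `X`-length of `M`: the minimal length of an `X`-filtration (only used for `M` in
`Filt(X)`). -/
noncomputable def filtLength (X : ObjectProperty C) (M : C) : ℕ :=
  sInf {n : ℕ | ∃ l : List C, HasFiltration.{w} X M l ∧ l.length = n}

/-- Two finite sequences of objects are isomorphic: they have the same length and agree up to a
permutation and isomorphisms (a bijection of the index sets forces the lengths to be equal). -/
def SeqIso (l l' : List C) : Prop :=
  ∃ σ : Fin l.length ≃ Fin l'.length, ∀ i, Nonempty (l.get i ≅ l'.get (σ i))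

/-- The conditions of the weak Jordan–Hölder property, for a given class `X` of objects. -/
structure SatisfiesWJHPWith (X : ObjectProperty C) : Prop where
  filt_eq_top : ∀ M : C, filt.{w} X M
  seqIso_of_minimal : ∀ (M : C) (l l' : List C), HasFiltration.{w} X M l →
    HasFiltration.{w} X M l' → l.length = filtLength.{w} X M → l'.length = filtLength.{w} X M →
    SeqIso l l'

/-- The conditions of the Jordan–Hölder property, for a given class `X` of objects. -/
structure SatisfiesJHPWith (X : ObjectProperty C) : Prop extends SatisfiesWJHPWith.{w} X where
  length_eq : ∀ (M : C) (l l' : List C), HasFiltration.{w} X M l → HasFiltration.{w} X M l' →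
    l.length = l'.length

variable (C) in
/-- The extriangulated category `C` satisfies the Jordan–Hölder property (JHP). -/
def SatisfiesJHP : Prop :=
  ∃ X : ObjectProperty C, SatisfiesJHPWith.{w} X

/-- The endomorphism ring of `M` is a division ring. -/
def IsBrick {C : Type u} [Category.{v} C] [Preadditive C] (M : C) : Prop :=
  Nontrivial (End M) ∧ ∀ f : End M, f ≠ 0 → IsUnit f

/-- A semibrick: bricks without nonzero morphisms between non-isomorphic ones. -/
structure IsSemibrick {C : Type u} [Category.{v} C] [Preadditive C] (X : ObjectProperty C) :
    Prop where
  isBrick : ∀ S : C, X S → IsBrick S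
  hom_eq_zero : ∀ S S' : C, X S → X S' → ¬ Nonempty (S ≅ S') → ∀ f : S ⟶ S', f = 0

/-- `N` is a `[1]`-shift of `M`: there is an `𝔼`-triangle `M ⟶ 0 ⟶ N ⇢`. -/
def IsShift (M N : C) : Prop :=
  IsConflation.{w} (0 : M ⟶ (0 : C)) (0 : (0 : C) ⟶ N)

/-- `X` is proper: `S[1] ∉ Filt(X)` for all `S ∈ X`. -/
def IsProper (X : ObjectProperty C) : Prop :=
  ∀ S : C, X S → ¬ ∃ N : C, filt.{w} X N ∧ IsShift.{w} S N

end Filtrations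

section ExtensionClosed

variable {C : Type u} [Category.{v} C] [Preadditive C] [HasZeroObject C]
  [HasFiniteBiproducts C] [Extriangulated.{w} C]

lemma extPull_zero {Z Z' A : C} (δ : ExtGroup (Extriangulated.E.{w} (C := C)) Z A) :
    extPull Extriangulated.E (0 : Z' ⟶ Z) δ = 0 := by
  have := Extriangulated.additive_left.{w} (C := C)
  simp [extPull, Functor.map_zero]

lemma extPull_id {Z A : C} (δ : ExtGroup (Extriangulated.E.{w} (C := C)) Z A) :
    extPull Extriangulated.E (𝟙 Z) δ = δ := by
  simp [extPull]

/-- An extension by a zero object is trivial. -/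
lemma exists_iso_of_isConflation_of_isZero {A B Z : C} {x : A ⟶ B} {y : B ⟶ Z}
    (h : IsConflation.{w} x y) (hZ : IsZero Z) : Nonempty (A ≅ B) := by
  obtain ⟨δ, hδ⟩ := h
  have h0 : δ = 0 := by
    rw [← extPull_id δ, hZ.eq_of_src (𝟙 Z) 0, extPull_zero]
  subst h0
  let b : BinaryBicone A Z :=
    { pt := A, fst := 𝟙 A, snd := 0, inl := 𝟙 A, inr := 0
      inr_snd := hZ.eq_of_src _ _ }
  have hb : IsDirectSum b := by simp [IsDirectSum, b]
  obtain ⟨e, -, -⟩ := Extriangulated.seqEquiv_of_realizes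
    (Extriangulated.realizes_zero b hb) hδ
  exact ⟨e⟩

lemma HasFiltration.of_iso {X : ObjectProperty C} {M N : C} {l : List C}
    (h : HasFiltration.{w} X M l) (e : M ≅ N) : HasFiltration.{w} X N l := by
  cases h with
  | nil hM => exact .nil (hM.of_iso e.symm)
  | snoc h f g hfg hS =>
    obtain ⟨δ, hδ⟩ := hfg
    exact .snoc h (f ≫ e.hom) (e.inv ≫ g)
      ⟨δ, Extriangulated.realizes_of_seqEquiv hδ ⟨e, rfl, by simp⟩⟩ hS

lemma HasFiltration.append {X : ObjectProperty C} {A B Z : C} {l l' : List C}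
    (hA : HasFiltration.{w} X A l) (hZ : HasFiltration.{w} X Z l') (x : A ⟶ B) (y : B ⟶ Z)
    (hxy : IsConflation.{w} x y) : HasFiltration.{w} X B (l ++ l') := by
  induction hZ generalizing B with
  | nil hM =>
    obtain ⟨e⟩ := exists_iso_of_isConflation_of_isZero hxy hM
    simpa using hA.of_iso e
  | snoc h f g hfg hS ih =>
    obtain ⟨δ, hδ⟩ := hxy
    obtain ⟨δ', hδ'⟩ := hfg
    obtain ⟨Q, d, e, h', δ'', h1, -, -, h2, -, -⟩ := Extriangulated.et4_op hδ hδ'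
    rw [← List.append_assoc]
    exact .snoc (ih d e ⟨_, h2⟩) h' (y ≫ g) ⟨_, h1⟩ hS

/-- The full subcategory `T` contains the zero objects and is closed under extensions (hence also
under isomorphisms and finite direct sums). -/
structure IsExtensionClosed (T : ObjectProperty C) : Prop where
  of_isZero : ∀ Z : C, IsZero Z → T Z
  of_isConflation : ∀ {A B Z : C} (x : A ⟶ B) (y : B ⟶ Z), IsConflation.{w} x y →
    T A → T Z → T B

lemma filt_isExtensionClosed (X : ObjectProperty C) :
    IsExtensionClosed.{w} (filt.{w} X) where
  of_isZero _ hZ := ⟨[], .nil hZ⟩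
  of_isConflation x y h := by
    rintro ⟨l, hl⟩ ⟨l', hl'⟩
    exact ⟨l ++ l', hl.append hl' x y h⟩

namespace IsExtensionClosed

variable {T : ObjectProperty C}

lemma hasZeroObject (hT : IsExtensionClosed.{w} T) : HasZeroObject T.FullSubcategory where
  zero := by
    refine ⟨⟨0, hT.of_isZero _ (isZero_zero C)⟩, ?_⟩
    rw [IsZero.iff_id_eq_zero]
    exact ObjectProperty.hom_ext _ ((isZero_zero C).eq_of_src _ _)

lemma hasFiniteBiproducts (hT : IsExtensionClosed.{w} T) :
    HasFiniteBiproducts T.FullSubcategory := by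
  have := hT.hasZeroObject
  have := hasBinaryBiproducts_of_finite_biproducts C
  have : HasBinaryBiproducts T.FullSubcategory := ⟨fun X Y => by
    let b := BinaryBiproduct.bicone X.obj Y.obj
    have hb : IsDirectSum b := biprod.total
    let P : T.FullSubcategory := ⟨b.pt, hT.of_isConflation b.inl b.snd
      ⟨_, Extriangulated.realizes_zero b hb⟩ X.property Y.property⟩
    let b' : BinaryBicone X Y :=
      { pt := P
        fst := ObjectProperty.homMk b.fst
        snd := ObjectProperty.homMk b.snd
        inl := ObjectProperty.homMk b.inl
        inr := ObjectProperty.homMk b.inr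
        inl_fst := ObjectProperty.hom_ext _ b.inl_fst
        inl_snd := ObjectProperty.hom_ext _ b.inl_snd
        inr_fst := ObjectProperty.hom_ext _ b.inr_fst
        inr_snd := ObjectProperty.hom_ext _ b.inr_snd }
    exact hasBinaryBiproduct_of_total b' (ObjectProperty.hom_ext _ hb)⟩
  have : HasFiniteProducts T.FullSubcategory := hasFiniteProducts_of_has_binary_and_terminal
  exact HasFiniteBiproducts.of_hasFiniteProducts

/-- The extriangulated structure of an extension-closed subcategory: `𝔼` and `𝔰` are the
restrictions of those of `C`. -/
@[reducible]
def extriangulated (hT : IsExtensionClosed.{w} T) [HasZeroObject T.FullSubcategory]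
    [HasFiniteBiproducts T.FullSubcategory] : Extriangulated.{w} T.FullSubcategory where
  E := T.ι.op ⋙ Extriangulated.E.{w} ⋙ (Functor.whiskeringLeft _ _ _).obj T.ι
  Realizes x y δ := Extriangulated.Realizes.{w} x.hom y.hom δ
  additive_left := by
    have := Extriangulated.additive_left.{w} (C := C)
    refine ⟨fun {X Y f g} => ?_⟩
    ext A : 2
    exact congrArg (fun t => NatTrans.app t A.obj)
      ((Extriangulated.E.{w} (C := C)).map_add (f := (T.ι.op.map f)) (g := (T.ι.op.map g)))
  additive_right Z := by
    have := Extriangulated.additive_right.{w} (C := C) (op Z.unop.obj)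
    exact ⟨fun {X Y f g} => ((Extriangulated.E.{w} (C := C)).obj (op Z.unop.obj)).map_add
      (f := f.hom) (g := g.hom)⟩
  exists_realization {A Z} δ := by
    obtain ⟨B, x, y, h⟩ := Extriangulated.exists_realization.{w} (A := A.obj) (Z := Z.obj) δ
    exact ⟨⟨B, hT.of_isConflation x y ⟨δ, h⟩ A.property Z.property⟩,
      ObjectProperty.homMk x, ObjectProperty.homMk y, h⟩
  seqEquiv_of_realizes h h' := by
    obtain ⟨e, h1, h2⟩ := Extriangulated.seqEquiv_of_realizes h h'
    exact ⟨T.isoMk e, ObjectProperty.hom_ext _ h1, ObjectProperty.hom_ext _ h2⟩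
  realizes_of_seqEquiv h := by
    rintro ⟨e, h1, h2⟩
    exact Extriangulated.realizes_of_seqEquiv h
      ⟨T.ι.mapIso e, congrArg (·.hom) h1, congrArg (·.hom) h2⟩
  lift_morphism h h' a c hac := by
    obtain ⟨b, h1, h2⟩ := Extriangulated.lift_morphism h h' a.hom c.hom hac
    exact ⟨ObjectProperty.homMk b, ObjectProperty.hom_ext _ h1, ObjectProperty.hom_ext _ h2⟩
  realizes_zero b hb :=
    Extriangulated.realizes_zero (fullSubcategoryBicone b) (isDirectSum_bicone hb)
  realizes_directSum h h' bA bB bZ hA hB hZ :=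
    Extriangulated.realizes_directSum h h' (fullSubcategoryBicone bA) (fullSubcategoryBicone bB) (fullSubcategoryBicone bZ)
      (isDirectSum_bicone hA) (isDirectSum_bicone hB) (isDirectSum_bicone hZ)
  et3 h h' a b hab := by
    obtain ⟨c, h1, h2⟩ := Extriangulated.et3 h h' a.hom b.hom (congrArg (·.hom) hab)
    exact ⟨ObjectProperty.homMk c, ObjectProperty.hom_ext _ h1, h2⟩
  et3_op h h' b c hbc := by
    obtain ⟨a, h1, h2⟩ := Extriangulated.et3_op h h' b.hom c.hom (congrArg (·.hom) hbc)
    exact ⟨ObjectProperty.homMk a, ObjectProperty.hom_ext _ h1, h2⟩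
  et4 {A B D Z F f f' g g' δ δ'} h h' := by
    obtain ⟨Q, d, e, k, δ'', h1, h2, h3, h4, h5, h6⟩ := Extriangulated.et4 h h'
    exact ⟨⟨Q, hT.of_isConflation d e ⟨_, h4⟩ D.property F.property⟩, ObjectProperty.homMk d,
      ObjectProperty.homMk e, ObjectProperty.homMk k, δ'', h1, ObjectProperty.hom_ext _ h2,
      ObjectProperty.hom_ext _ h3, h4, h5, h6⟩
  et4_op {D A B F Z f' f g' g δ δ'} h h' := by
    obtain ⟨Q, d, e, k, δ'', h1, h2, h3, h4, h5, h6⟩ := Extriangulated.et4_op h h'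
    exact ⟨⟨Q, hT.of_isConflation d e ⟨_, h4⟩ D.property F.property⟩, ObjectProperty.homMk d,
      ObjectProperty.homMk e, ObjectProperty.homMk k, δ'', h1, ObjectProperty.hom_ext _ h2,
      ObjectProperty.hom_ext _ h3, h4, h5, h6⟩

end IsExtensionClosed

instance filt_hasZeroObject (X : ObjectProperty C) :
    HasZeroObject (filt.{w} X).FullSubcategory :=
  (filt_isExtensionClosed X).hasZeroObject

instance filt_hasFiniteBiproducts (X : ObjectProperty C) :
    HasFiniteBiproducts (filt.{w} X).FullSubcategory :=
  (filt_isExtensionClosed X).hasFiniteBiproducts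

/-- `Filt(X)` as an extriangulated category. -/
instance filt_extriangulated (X : ObjectProperty C) :
    Extriangulated.{w} (filt.{w} X).FullSubcategory :=
  (filt_isExtensionClosed X).extriangulated

end ExtensionClosed

/-! If the lengths of `Y`-filtrations are unique, an `𝔼`-triangle `S ⟶ 0 ⟶ N` in `Filt(X)` is
impossible for `S` in `X`: concatenating `Y`-filtrations of `S` and `N` filters `0`, so both are
empty and the brick `S` is zero.

For the converse, Schur's lemma extends to filtered objects (`HasFiltration.exists_cone`): a nonzero
map from `S` in `X` to `M` is an inflation, and its cone is filtered by the factors of `M` with one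
copy of `S` removed. Properness ensures that every inflation from `S` to a filtered object with
filtered cone is nonzero (`IsProper.inflation_ne_zero`): a zero inflation into `M` yields one into
an object with fewer factors, ending with `S ⟶ 0 ⟶ N`. Now take the first step `S ⟶ M` of one
filtration. It is nonzero, so `S` also occurs in the other; by uniqueness of cones the remaining
factors of both filter the same object, and induction gives the permutation. -/

/-! ### Exactness, uniqueness of cones and splitting of conflations -/

section ExactSequences

variable {C : Type u} [Category.{v} C] [Preadditive C] [HasZeroObject C]
  [HasFiniteBiproducts C] [Extriangulated.{w} C]

lemma extPush_zero {Z A A' : C} (δ : ExtGroup (Extriangulated.E.{w} (C := C)) Z A) :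
    extPush Extriangulated.E (0 : A ⟶ A') δ = 0 := by
  have := Extriangulated.additive_right.{w} (C := C) (op Z)
  simp [extPush, Functor.map_zero]

lemma extPush_apply_zero {Z A A' : C} (a : A ⟶ A') :
    extPush Extriangulated.E a (0 : ExtGroup (Extriangulated.E.{w} (C := C)) Z A) = 0 :=
  map_zero _

lemma extPull_apply_zero {Z Z' A : C} (c : Z' ⟶ Z) :
    extPull Extriangulated.E c (0 : ExtGroup (Extriangulated.E.{w} (C := C)) Z A) = 0 :=
  map_zero _

lemma extPull_comp {Z Z' Z'' A : C} (c' : Z'' ⟶ Z') (c : Z' ⟶ Z)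
    (δ : ExtGroup (Extriangulated.E.{w} (C := C)) Z A) :
    extPull Extriangulated.E (c' ≫ c) δ =
      extPull Extriangulated.E c' (extPull Extriangulated.E c δ) := by
  simp [extPull]

lemma extPull_sub {Z Z' A : C} (c c' : Z' ⟶ Z)
    (δ : ExtGroup (Extriangulated.E.{w} (C := C)) Z A) :
    extPull Extriangulated.E (c - c') δ =
      extPull Extriangulated.E c δ - extPull Extriangulated.E c' δ := by
  have := Extriangulated.additive_left.{w} (C := C)
  simp [extPull, Functor.map_sub]

/-- This conflation and `0 ⟶ Z ⟶ Z` are the test objects: comparing a conflation with them by the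
axioms gives the exactness statements below. -/
lemma realizes_id_zero (A : C) {Z : C} (hZ : IsZero Z) :
    Extriangulated.Realizes.{w} (𝟙 A) (0 : A ⟶ Z) 0 := by
  let b : BinaryBicone A Z :=
    { pt := A, fst := 𝟙 A, snd := 0, inl := 𝟙 A, inr := 0
      inr_snd := hZ.eq_of_src _ _ }
  exact Extriangulated.realizes_zero b (by simp [IsDirectSum, b])

lemma realizes_zero_id (Z : C) {A : C} (hA : IsZero A) :
    Extriangulated.Realizes.{w} (0 : A ⟶ Z) (𝟙 Z) 0 := by
  let b : BinaryBicone A Z :=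
    { pt := Z, fst := 0, snd := 𝟙 Z, inl := 0, inr := 𝟙 Z
      inl_fst := hA.eq_of_src _ _ }
  exact Extriangulated.realizes_zero b (by simp [IsDirectSum, b])

variable {A B Z : C} {x : A ⟶ B} {y : B ⟶ Z}

lemma IsConflation.comp_eq_zero (h : IsConflation.{w} x y) : x ≫ y = 0 := by
  obtain ⟨δ, h⟩ := h
  obtain ⟨c, h1, -⟩ := Extriangulated.et3 (realizes_id_zero A (isZero_zero C)) h (𝟙 A) x rfl
  simpa using h1.symm

lemma extPull_eq_zero_of_realizes {δ : ExtGroup (Extriangulated.E.{w} (C := C)) Z A}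
    (h : Extriangulated.Realizes x y δ) : extPull Extriangulated.E y δ = 0 := by
  obtain ⟨c, h1, h2⟩ := Extriangulated.et3 (realizes_zero_id B (isZero_zero C)) h 0 (𝟙 B)
    (by simp)
  obtain rfl : c = y := by simpa using h1
  rw [← h2, extPush_apply_zero]

/-- Exactness of `Hom(W, A) ⟶ Hom(W, B) ⟶ Hom(W, Z)`. -/
lemma IsConflation.exists_lift (h : IsConflation.{w} x y) {W : C} (f : W ⟶ B) (hf : f ≫ y = 0) :
    ∃ g : W ⟶ A, g ≫ x = f := by
  obtain ⟨δ, h⟩ := h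
  obtain ⟨a, h1, -⟩ := Extriangulated.et3_op (realizes_id_zero W (isZero_zero C)) h f 0
    (by simp [hf])
  exact ⟨a, by simpa using h1.symm⟩

/-- Exactness of `Hom(Z, W) ⟶ Hom(B, W) ⟶ Hom(A, W)`. -/
lemma IsConflation.exists_desc (h : IsConflation.{w} x y) {W : C} (f : B ⟶ W) (hf : x ≫ f = 0) :
    ∃ g : Z ⟶ W, y ≫ g = f := by
  obtain ⟨δ, h⟩ := h
  obtain ⟨c, h1, -⟩ := Extriangulated.et3 h (realizes_zero_id W (isZero_zero C)) 0 f
    (by simp [hf])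
  exact ⟨c, by simpa using h1⟩

/-- Exactness of `Hom(W, B) ⟶ Hom(W, Z) ⟶ 𝔼(W, A)`. -/
lemma exists_lift_of_extPull_eq_zero {δ : ExtGroup (Extriangulated.E.{w} (C := C)) Z A}
    (h : Extriangulated.Realizes x y δ) {W : C} (u : W ⟶ Z)
    (hu : extPull Extriangulated.E u δ = 0) : ∃ v : W ⟶ B, v ≫ y = u := by
  obtain ⟨b, -, h2⟩ := Extriangulated.lift_morphism (realizes_zero_id W (isZero_zero C)) h 0 u
    (by rw [hu, extPush_apply_zero])
  exact ⟨b, by simpa using h2.symm⟩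

lemma exists_retraction_of_realizes_zero
    (h : Extriangulated.Realizes x y (0 : ExtGroup (Extriangulated.E.{w} (C := C)) Z A)) :
    ∃ r : B ⟶ A, x ≫ r = 𝟙 A := by
  obtain ⟨b, h1, -⟩ := Extriangulated.lift_morphism h (realizes_id_zero A (isZero_zero C)) (𝟙 A) 0
    (by rw [extPush_apply_zero, extPull_apply_zero])
  exact ⟨b, by simpa using h1⟩

/-- The difference `c - 𝟙 Z` factors through `y` and is killed by precomposition with `y`, so it
squares to zero and `c` has inverse `𝟙 Z - (c - 𝟙 Z)`. -/
lemma isIso_of_realizes_comp {δ : ExtGroup (Extriangulated.E.{w} (C := C)) Z A}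
    (h : Extriangulated.Realizes x y δ) (c : Z ⟶ Z) (hy : y ≫ c = y)
    (hc : extPull Extriangulated.E c δ = δ) : IsIso c := by
  obtain ⟨v, hv⟩ := exists_lift_of_extPull_eq_zero h (c - 𝟙 Z)
    (by rw [extPull_sub, hc, extPull_id, sub_self])
  have hu : (c - 𝟙 Z) ≫ (c - 𝟙 Z) = 0 := by
    nth_rw 1 [← hv]
    simp [hy]
  have hc' : c ≫ c = c + c - 𝟙 Z := by
    rw [← sub_eq_zero, ← hu]
    simp only [Preadditive.comp_sub, Preadditive.sub_comp, Category.comp_id, Category.id_comp]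
    abel
  refine ⟨𝟙 Z + 𝟙 Z - c, ?_, ?_⟩
  · simp [Preadditive.comp_sub, Preadditive.comp_add, hc']
  · simp [Preadditive.sub_comp, Preadditive.add_comp, hc']

/-- The cone of an inflation is unique up to isomorphism. -/
lemma nonempty_iso_of_isConflation {Z' : C} {y' : B ⟶ Z'} (h : IsConflation.{w} x y)
    (h' : IsConflation.{w} x y') : Nonempty (Z ≅ Z') := by
  obtain ⟨δ, h⟩ := h
  obtain ⟨δ', h'⟩ := h'
  have push_id : ∀ {W : C} (ε : ExtGroup (Extriangulated.E.{w} (C := C)) W A),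
      extPush Extriangulated.E (𝟙 A) ε = ε := fun ε => by simp [extPush]
  obtain ⟨c, h1, h2⟩ := Extriangulated.et3 h h' (𝟙 A) (𝟙 B) (by simp)
  obtain ⟨c', h1', h2'⟩ := Extriangulated.et3 h' h (𝟙 A) (𝟙 B) (by simp)
  rw [push_id] at h2 h2'
  rw [Category.id_comp] at h1 h1'
  have i1 : IsIso (c ≫ c') := isIso_of_realizes_comp h _ (by rw [← Category.assoc, h1, h1'])
    (by rw [extPull_comp, ← h2', ← h2])
  have i2 : IsIso (c' ≫ c) := isIso_of_realizes_comp h' _ (by rw [← Category.assoc, h1', h1])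
    (by rw [extPull_comp, ← h2, ← h2'])
  have : IsSplitMono c := ⟨⟨c' ≫ inv (c ≫ c'), by rw [← Category.assoc, IsIso.hom_inv_id]⟩⟩
  have : IsSplitEpi c := ⟨⟨inv (c' ≫ c) ≫ c', by rw [Category.assoc, IsIso.inv_hom_id]⟩⟩
  have : IsIso c := isIso_of_epi_of_isSplitMono c
  exact ⟨asIso c⟩

/-- A morphism to the middle term of a conflation whose composite with the deflation is an
isomorphism is a split inflation, complementary to the given one. -/
lemma IsConflation.exists_complement (h : IsConflation.{w} x y) {S : C} (f : S ⟶ B)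
    [IsIso (f ≫ y)] : ∃ r : B ⟶ A, IsConflation.{w} f r ∧ x ≫ r = 𝟙 A := by
  have hxy := h.comp_eq_zero
  obtain ⟨δ, hδ⟩ := id h
  -- Pulling back along `y` kills `δ`, hence so does pulling back along the isomorphism `f ≫ y`.
  have h0 : δ = 0 := by
    rw [← extPull_id δ, ← IsIso.inv_hom_id (f ≫ y), ← Category.assoc, extPull_comp,
      extPull_eq_zero_of_realizes hδ, extPull_apply_zero]
  subst h0
  obtain ⟨r, hr⟩ := exists_retraction_of_realizes_zero hδ
  set p : B ⟶ S := y ≫ inv (f ≫ y) with hp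
  have hfp : f ≫ p = 𝟙 S := by rw [hp, ← Category.assoc, IsIso.hom_inv_id]
  have hxp : x ≫ p = 0 := by rw [hp, ← Category.assoc, hxy, zero_comp]
  have hpy : p ≫ f ≫ y = y := by simp [hp]
  -- Corrects `r` so that it kills `f`; it remains a retraction of `x` because `x ≫ p = 0`.
  let r' : B ⟶ A := r - p ≫ f ≫ r
  have hxr : x ≫ r' = 𝟙 A := by
    simp only [r', Preadditive.comp_sub, hr]
    rw [← Category.assoc, hxp, zero_comp, sub_zero]
  have hfr : f ≫ r' = 0 := by
    simp only [r', Preadditive.comp_sub]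
    rw [← Category.assoc f p, hfp, Category.id_comp, sub_self]
  let b : BinaryBicone S A :=
    { pt := B, fst := p, snd := r', inl := f, inr := x
      inl_fst := hfp, inl_snd := hfr, inr_fst := hxp, inr_snd := hxr }
  -- The defect of the biproduct identity factors through `x`; composing with `r'` shows that the
  -- factor vanishes.
  obtain ⟨v, hv⟩ := h.exists_lift (𝟙 B - p ≫ f - r' ≫ x)
    (by simp [Preadditive.sub_comp, hpy, hxy])
  have hv0 : v = 0 := by
    rw [← Category.comp_id v, ← hxr, ← Category.assoc, hv]
    simp [Preadditive.sub_comp, hfr, hxr]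
  have hb : IsDirectSum b := by
    rw [hv0, zero_comp, eq_comm, sub_sub, sub_eq_zero] at hv
    exact hv.symm
  exact ⟨r', ⟨0, Extriangulated.realizes_zero b hb⟩, hxr⟩

end ExactSequences

/-! ### Maps from a semibrick to filtered objects -/

section Semibricks

variable {C : Type u} [Category.{v} C] [Preadditive C]

lemma IsBrick.not_isZero {S : C} (h : IsBrick S) : ¬ IsZero S := fun hS =>
  have := h.1
  one_ne_zero (α := End S) (hS.eq_of_src _ _)

lemma IsSemibrick.isIso_of_ne_zero {X : ObjectProperty C} (hX : IsSemibrick X) {S S' : C}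
    (hS : X S) (hS' : X S') (f : S ⟶ S') (hf : f ≠ 0) : IsIso f := by
  have hne : Nonempty (S ≅ S') := by
    by_contra h
    exact hf (hX.hom_eq_zero S S' hS hS' h f)
  obtain ⟨e⟩ := hne
  have hu : IsUnit (show End S from f ≫ e.inv) := (hX.isBrick S hS).2 _ fun h => hf <| by
    rw [← Category.comp_id f, ← e.inv_hom_id, ← Category.assoc]
    exact (congrArg (· ≫ e.hom) h).trans zero_comp
  have : IsIso (f ≫ e.inv) := (isUnit_iff_isIso _).1 hu
  exact IsIso.of_isIso_comp_right f e.inv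

variable [HasZeroObject C] [HasFiniteBiproducts C] [Extriangulated.{w} C] {X : ObjectProperty C}

lemma HasFiltration.isZero {M : C} (h : HasFiltration.{w} X M []) : IsZero M := by
  generalize hl : ([] : List C) = l at h
  cases h with
  | nil hM => exact hM
  | snoc => simp at hl

/-- A nonzero morphism out of a filtered object yields one out of a member of `X`. -/
lemma HasFiltration.exists_ne_zero {M W : C} {l : List C} (h : HasFiltration.{w} X M l)
    (f : M ⟶ W) (hf : f ≠ 0) : ∃ (S : C) (g : S ⟶ W), X S ∧ g ≠ 0 := by
  induction h with
  | nil hM => exact absurd (hM.eq_of_src _ _) hf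
  | snoc h x y hxy hS ih =>
    by_cases hx : x ≫ f = 0
    · obtain ⟨g, rfl⟩ := hxy.exists_desc f hx
      exact ⟨_, g, hS, fun hg => hf (by rw [hg, comp_zero])⟩
    · exact ih _ hx

/-- A nonzero morphism from a member of a semibrick to a filtered object is an inflation, and its
cone is filtered by the remaining factors. -/
lemma HasFiltration.exists_cone (hX : IsSemibrick X) {M S : C} {l : List C}
    (h : HasFiltration.{w} X M l) (hS : X S) (f : S ⟶ M) (hf : f ≠ 0) :
    ∃ (N : C) (g : M ⟶ N) (l₁ l₂ : List C) (S' : C), IsConflation.{w} f g ∧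
      l = l₁ ++ S' :: l₂ ∧ Nonempty (S ≅ S') ∧ HasFiltration.{w} X N (l₁ ++ l₂) := by
  induction h with
  | nil hM => exact absurd (hM.eq_of_tgt _ _) hf
  | @snoc M' M S' l h x y hxy hS' ih =>
    by_cases hy : f ≫ y = 0
    · obtain ⟨f', rfl⟩ := hxy.exists_lift f hy
      obtain ⟨N, g, l₁, l₂, T, ⟨δ, hδ⟩, rfl, e, hN⟩ :=
        ih f' (fun h0 => hf (by rw [h0, zero_comp]))
      obtain ⟨δ', hδ'⟩ := hxy
      -- The cone `Q` of the composite is an extension of the last factor `S'` by the cone `N` of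
      -- `f'`, so `S'` survives.
      obtain ⟨Q, d, e', h', δ'', h1, -, -, h2, -, -⟩ := Extriangulated.et4 hδ hδ'
      refine ⟨Q, h', l₁, l₂ ++ [S'], T, ⟨_, h1⟩, by simp, e, ?_⟩
      rw [← List.append_assoc]
      exact .snoc hN d e' ⟨_, h2⟩ hS'
    -- Here `f` splits off the last factor, and the cone is `M'` itself.
    · have := hX.isIso_of_ne_zero hS hS' _ hy
      obtain ⟨r, hr, -⟩ := hxy.exists_complement f
      exact ⟨M', r, l, [], S', hr, rfl, ⟨asIso (f ≫ y)⟩, by simpa using h⟩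

/-- The first step of a filtration. -/
lemma HasFiltration.exists_head {M S : C} {l : List C} (h : HasFiltration.{w} X M (S :: l)) :
    ∃ (N : C) (f : S ⟶ M) (g : M ⟶ N), X S ∧ IsConflation.{w} f g ∧
      HasFiltration.{w} X N l := by
  generalize hm : S :: l = m at h
  induction h generalizing l with
  | nil => simp at hm
  | @snoc M' M S' m h x y hxy hS' ih =>
    cases m with
    | nil =>
      obtain ⟨rfl, rfl⟩ : S = S' ∧ l = [] := by simpa using hm
      obtain ⟨δ, hδ⟩ := hxy
      -- With a single factor, `M'` is zero, so the conflation splits and can be turned around.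
      have h0 : δ = 0 := by
        have hid : extPush Extriangulated.E (𝟙 M') δ = δ := by simp [extPush]
        rw [← hid, h.isZero.eq_of_src (𝟙 M') 0, extPush_zero]
      obtain ⟨s, hs⟩ := exists_lift_of_extPull_eq_zero hδ (𝟙 S) (by rw [h0, extPull_apply_zero])
      have : IsIso (s ≫ y) := by rw [hs]; infer_instance
      obtain ⟨r, hr, -⟩ := IsConflation.exists_complement ⟨δ, hδ⟩ s
      exact ⟨M', s, r, hS', hr, h⟩
    | cons T m =>
      obtain ⟨rfl, rfl⟩ : S = T ∧ l = m ++ [S'] := by simpa using hm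
      obtain ⟨N, f, g, hS, ⟨δ, hδ⟩, hN⟩ := ih rfl
      obtain ⟨δ', hδ'⟩ := hxy
      obtain ⟨Q, d, e', h', δ'', h1, -, -, h2, -, -⟩ := Extriangulated.et4 hδ hδ'
      exact ⟨Q, f ≫ x, h', hS, ⟨_, h1⟩, .snoc hN d e' ⟨_, h2⟩ hS'⟩

/-- If `S ⟶ M` is a zero inflation and `f : S₁ ⟶ M` is an inflation that stays one on the cone `N`
of `S ⟶ M`, then `S ⟶ M₁` is a zero inflation for the cone `M₁` of `f`. -/
lemma IsConflation.exists_zero_inflation {S S₁ M N N₁ : C} {y : M ⟶ N} {k : N ⟶ N₁}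
    {f : S₁ ⟶ M} (h : IsConflation.{w} (0 : S ⟶ M) y) (hk : IsConflation.{w} (f ≫ y) k) :
    ∃ (M₁ : C) (g : M ⟶ M₁) (z : M₁ ⟶ N₁), IsConflation.{w} f g ∧
      IsConflation.{w} (0 : S ⟶ M₁) z := by
  -- Since `S ⟶ M` is zero, `y` is a split monomorphism.
  obtain ⟨q, hq⟩ := h.exists_desc (𝟙 M) zero_comp
  obtain ⟨δ, hδ⟩ := h
  obtain ⟨δ', hδ'⟩ := hk
  obtain ⟨Q, d, e, h', δ'', h1, h2, h3, h4, -, -⟩ := Extriangulated.et4_op hδ hδ'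
  have hh' : h' = e ≫ f := by
    rw [← Category.comp_id h', ← hq, ← Category.assoc, h3]
    simp [hq]
  -- Hence the extension `S ⟶ Q ⟶ S₁` splits. Its section `s` has cone `S`, and `s ≫ h' = f`, so
  -- (ET4) for `s` and `h'` gives a conflation `S ⟶ M₁ ⟶ N₁`.
  have h0 : extPull Extriangulated.E (f ≫ y) δ = 0 := by
    rw [extPull_comp, extPull_eq_zero_of_realizes hδ, extPull_apply_zero]
  obtain ⟨s, hs⟩ := exists_lift_of_extPull_eq_zero h4 (𝟙 S₁) (by rw [h0, extPull_apply_zero])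
  have : IsIso (s ≫ e) := by rw [hs]; infer_instance
  obtain ⟨r, ⟨ε, hr⟩, hdr⟩ := IsConflation.exists_complement ⟨_, h4⟩ s
  obtain ⟨M₁, d', z, g, ε', i1, i2, -, i3, -, -⟩ := Extriangulated.et4 hr h1
  have hsf : s ≫ h' = f := by rw [hh', ← Category.assoc, hs, Category.id_comp]
  -- Through `d ≫ r = 𝟙 S`, the map `d'` equals `d ≫ h' ≫ g`, and `d ≫ h'` is the original zero
  -- inflation.
  have hd' : d' = 0 := by
    rw [← Category.id_comp d', ← hdr, Category.assoc, i2, ← Category.assoc, h2, zero_comp]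
  subst hd'
  rw [hsf] at i1
  exact ⟨M₁, g, z, ⟨_, i1⟩, ⟨_, i3⟩⟩

/-- For a proper semibrick, inflations from its members in the filtration subcategory are
nonzero. -/
lemma IsProper.inflation_ne_zero (hX : IsSemibrick X) (hp : IsProper.{w} X) {S M N : C} (hS : X S)
    {x : S ⟶ M} {y : M ⟶ N} (h : IsConflation.{w} x y) (hM : filt.{w} X M)
    (hN : filt.{w} X N) : x ≠ 0 := by
  rintro rfl
  obtain ⟨l, hl⟩ := hM
  induction hn : l.length using Nat.strong_induction_on generalizing l M N with
  | _ n ih =>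
    by_cases hM : IsZero M
    · obtain ⟨δ, hδ⟩ := h
      exact hp S hS ⟨N, hN, δ, Extriangulated.realizes_of_seqEquiv hδ
        ⟨hM.iso (isZero_zero C), (isZero_zero C).eq_of_tgt _ _, hM.eq_of_src _ _⟩⟩
    · obtain ⟨S₁, f, hS₁, hf⟩ :=
        hl.exists_ne_zero (𝟙 M) fun h0 => hM ((IsZero.iff_id_eq_zero M).2 h0)
      obtain ⟨q, hq⟩ := h.exists_desc (𝟙 M) zero_comp
      have hfy : f ≫ y ≠ 0 := fun h0 => hf <| by
        rw [← Category.comp_id f, ← hq, ← Category.assoc, h0, zero_comp]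
      obtain ⟨m, hm⟩ := hN
      obtain ⟨N₁, k, m₁, m₂, -, hk, -, -, hN₁⟩ := hm.exists_cone hX hS₁ (f ≫ y) hfy
      obtain ⟨M₁, g, z, hg, hz⟩ := h.exists_zero_inflation hk
      -- `M₁` and `M₁'` are both cones of `f`, so `M₁` inherits a filtration with one factor fewer.
      obtain ⟨M₁', g', l₁, l₂, T, hg', rfl, -, hM₁⟩ := hl.exists_cone hX hS₁ f hf
      obtain ⟨e⟩ := nonempty_iso_of_isConflation hg' hg
      exact ih (l₁ ++ l₂).length (by simp at hn ⊢; omega) ⟨_, hN₁⟩ hz _ (hM₁.of_iso e) rfl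

end Semibricks

/-! ### Isomorphism of sequences of objects -/

section SeqIso

variable {C : Type u} [Category.{v} C]

lemma SeqIso.cons {S S' : C} {l l' : List C} (e : Nonempty (S ≅ S')) (h : SeqIso l l') :
    SeqIso (S :: l) (S' :: l') := by
  obtain ⟨σ, hσ⟩ := h
  refine ⟨(finSuccEquiv _).trans ((Equiv.optionCongr σ).trans (finSuccEquiv _).symm), ?_⟩
  refine Fin.cases ?_ fun i => ?_
  · simpa using e
  · simpa using hσ i

lemma SeqIso.trans {l₁ l₂ l₃ : List C} (h : SeqIso l₁ l₂) (h' : SeqIso l₂ l₃) :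
    SeqIso l₁ l₃ := by
  obtain ⟨σ, hσ⟩ := h
  obtain ⟨τ, hτ⟩ := h'
  refine ⟨σ.trans τ, fun i => ?_⟩
  obtain ⟨e⟩ := hσ i
  obtain ⟨e'⟩ := hτ (σ i)
  exact ⟨e ≪≫ e'⟩

lemma SeqIso.refl (l : List C) : SeqIso l l := ⟨Equiv.refl _, fun _ => ⟨Iso.refl _⟩⟩

lemma List.Perm.seqIso {l l' : List C} (h : l.Perm l') : SeqIso l l' := by
  induction h with
  | nil => exact .refl _
  | cons S _ ih => exact .cons ⟨Iso.refl S⟩ ih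
  | swap S T l =>
    refine ⟨Equiv.swap (0 : Fin (l.length + 2)) 1, ?_⟩
    refine Fin.cases ?_ (Fin.cases ?_ fun i => ?_)
    · rw [Equiv.swap_apply_left]
      exact ⟨Iso.refl _⟩
    · erw [Equiv.swap_apply_right]
      exact ⟨Iso.refl _⟩
    · rw [Equiv.swap_apply_of_ne_of_ne (by simp) (by simp [Fin.ext_iff])]
      exact ⟨Iso.refl _⟩
  | trans _ _ ih ih' => exact ih.trans ih'

lemma SeqIso.length_eq {l l' : List C} (h : SeqIso l l') : l.length = l'.length := by
  obtain ⟨σ, -⟩ := h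
  simpa using Fintype.card_congr σ

lemma SeqIso.of_map {T : ObjectProperty C} {l l' : List T.FullSubcategory}
    (h : SeqIso (l.map T.ι.obj) (l'.map T.ι.obj)) : SeqIso l l' := by
  obtain ⟨σ, hσ⟩ := h
  refine ⟨(finCongr (by simp)).trans (σ.trans (finCongr (by simp))), fun i => ?_⟩
  obtain ⟨e⟩ := hσ (finCongr (by simp) i)
  exact ⟨T.isoMk ((eqToIso (by simp)).trans (e.trans (eqToIso (by simp))))⟩

end SeqIso

/-! ### The Jordan–Hölder theorem and its converse -/

section JordanHolder

lemma isZero_obj_iff {C : Type u} [Category.{v} C] [Preadditive C] {T : ObjectProperty C}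
    {M : T.FullSubcategory} : IsZero M.obj ↔ IsZero M := by
  rw [IsZero.iff_id_eq_zero, IsZero.iff_id_eq_zero]
  exact ⟨fun h => ObjectProperty.hom_ext _ h, fun h => congrArg (·.hom) h⟩

variable {C : Type u} [Category.{v} C] [Preadditive C] [HasZeroObject C] [HasFiniteBiproducts C]
  [Extriangulated.{w} C] {X : ObjectProperty C}

/-- The Jordan–Hölder theorem for filtrations by a proper semibrick. -/
lemma HasFiltration.seqIso (hX : IsSemibrick X) (hp : IsProper.{w} X) {M : C} {l l' : List C}
    (h : HasFiltration.{w} X M l) (h' : HasFiltration.{w} X M l') : SeqIso l l' := by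
  induction l' generalizing M l with
  | nil =>
    cases l with
    | nil => exact .refl _
    | cons S l =>
      obtain ⟨N, f, g, hS, hfg, hN⟩ := h.exists_head
      exact absurd (h'.isZero.eq_of_tgt _ _) (hp.inflation_ne_zero hX hS hfg ⟨_, h⟩ ⟨_, hN⟩)
  | cons S l' ih =>
    obtain ⟨N, f, g, hS, hfg, hN⟩ := h'.exists_head
    obtain ⟨N', g', l₁, l₂, S', hfg', rfl, ⟨e⟩, hN'⟩ :=
      h.exists_cone hX hS f (hp.inflation_ne_zero hX hS hfg ⟨_, h⟩ ⟨_, hN⟩)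
    obtain ⟨i⟩ := nonempty_iso_of_isConflation hfg' hfg
    exact List.perm_middle.seqIso.trans (.cons ⟨e.symm⟩ (ih (hN'.of_iso i) hN))

lemma filt_of_mem {S : C} (hS : X S) : filt.{w} X S :=
  ⟨_, .snoc (.nil (isZero_zero C)) 0 (𝟙 S) ⟨0, realizes_zero_id S (isZero_zero C)⟩ hS⟩

/-- All intermediate terms of an `X`-filtration are themselves in `Filt(X)`, so the filtration
already lives in that subcategory. -/
lemma HasFiltration.filt_fullSubcategory {M : C} {l : List C} (h : HasFiltration.{w} X M l)
    (hM : filt.{w} X M) :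
    filt.{w} (X.inverseImage (filt.{w} X).ι) (⟨M, hM⟩ : (filt.{w} X).FullSubcategory) := by
  induction h with
  | nil h0 => exact ⟨[], .nil (isZero_obj_iff.1 h0)⟩
  | @snoc M' M S l h x y hxy hS ih =>
    obtain ⟨m, hm⟩ := ih ⟨_, h⟩
    obtain ⟨δ, hδ⟩ := hxy
    let M₁ : (filt.{w} X).FullSubcategory := ⟨M', _, h⟩
    let M₂ : (filt.{w} X).FullSubcategory := ⟨M, hM⟩
    let S₁ : (filt.{w} X).FullSubcategory := ⟨S, filt_of_mem hS⟩
    exact ⟨m ++ [S₁], .snoc hm (ObjectProperty.homMk x : M₁ ⟶ M₂)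
      (ObjectProperty.homMk y : M₂ ⟶ S₁) ⟨δ, hδ⟩ hS⟩

lemma HasFiltration.of_fullSubcategory {M : (filt.{w} X).FullSubcategory}
    {l : List (filt.{w} X).FullSubcategory}
    (h : HasFiltration.{w} (X.inverseImage (filt.{w} X).ι) M l) :
    HasFiltration.{w} X M.obj (l.map (filt.{w} X).ι.obj) := by
  induction h with
  | nil hM => exact .nil (isZero_obj_iff.2 hM)
  | snoc _ x y hxy hS ih =>
    obtain ⟨δ, hδ⟩ := hxy
    rw [List.map_append]
    exact .snoc ih x.hom y.hom ⟨δ, hδ⟩ hS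

lemma IsProper.satisfiesJHPWith (hX : IsSemibrick X) (hp : IsProper.{w} X) :
    SatisfiesJHPWith.{w} (X.inverseImage (filt.{w} X).ι) where
  filt_eq_top M := M.property.choose_spec.filt_fullSubcategory M.property
  seqIso_of_minimal _ _ _ h h' _ _ :=
    (h.of_fullSubcategory.seqIso hX hp h'.of_fullSubcategory).of_map
  length_eq _ _ _ h h' :=
    (h.of_fullSubcategory.seqIso hX hp h'.of_fullSubcategory).of_map.length_eq

lemma SatisfiesJHP.isProper (hX : IsSemibrick X)
    (h : SatisfiesJHP.{w} (filt.{w} X).FullSubcategory) : IsProper.{w} X := by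
  rintro S hS ⟨N, hN, δ, hδ⟩
  obtain ⟨Y, hY⟩ := h
  let S' : (filt.{w} X).FullSubcategory := ⟨S, filt_of_mem hS⟩
  let N' : (filt.{w} X).FullSubcategory := ⟨N, hN⟩
  let Z : (filt.{w} X).FullSubcategory :=
    ⟨0, (filt_isExtensionClosed X).of_isZero 0 (isZero_zero C)⟩
  have hZ : IsZero Z := isZero_obj_iff.1 (isZero_zero C)
  obtain ⟨l, hl⟩ := hY.filt_eq_top S'
  obtain ⟨m, hm⟩ := hY.filt_eq_top N'
  -- A filtration of the zero object, to be compared with the empty one.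
  have hlm := hl.append hm (0 : S' ⟶ Z) (0 : Z ⟶ N') ⟨δ, hδ⟩
  have h0 := hY.length_eq Z _ _ hlm (.nil hZ)
  obtain rfl : l = [] := by
    rw [← List.length_eq_zero_iff]
    simp at h0
    simp [h0.1]
  exact (hX.isBrick S hS).not_isZero (isZero_obj_iff.2 hl.isZero)

end JordanHolder

theorem theorem3p9 {C : Type u} [Category.{v} C] [Preadditive C] [HasZeroObject C]
    [HasFiniteBiproducts C] [Extriangulated.{w} C] (X : ObjectProperty C) (hX : IsSemibrick X) :
    (SatisfiesJHP.{w} (filt.{w} X).FullSubcategory ↔ IsProper.{w} X) ∧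
      (SatisfiesJHPWith.{w} (X.inverseImage (filt.{w} X).ι) ↔ IsProper.{w} X) :=
  ⟨⟨fun h => h.isProper hX, fun hp => ⟨_, hp.satisfiesJHPWith hX⟩⟩,
    ⟨fun h => SatisfiesJHP.isProper hX ⟨_, h⟩, fun hp => hp.satisfiesJHPWith hX⟩⟩
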